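/- There is an absolute constant $C\in\mathbb N$ such that the following holds for all integers $n\ge 3$ and all real $\varepsilon>0$. Put $k=\big\lfloor \sqrt n\,\max\{1,\tfrac1\varepsilon\}\,(\ln n)^C\big\rfloor$, so that $k=\big\lfloor\tfrac{\sqrt n}{\varepsilon}(\ln n)^C\big\rfloor$ when $\varepsilon\le 1$. (1) Let $\mu$ be a probability distribution on the unit sphere $\mathbb S^{n-1}\subset\mathbb R^n$ with $$\varepsilon\,\|\mathbb E_\mu x\|^2<\big\|\mathbb E_\mu xx^{\top}-(\mathbb E_\mu x)(\mathbb E_\mu x)^{\top}\big\|_F ,$$ where $\|\cdot\|_F$ is the Frobenius norm. Then there is a sum-of-squares polynomial $p\in\mathbb R[x_1,\dots,x_n]$ of degree at most $k$ with $\mathbb E_\mu p=1$ such that the reweighted probability distribution $\mu'=p\cdot\mu$ on $\mathbb S^{n-1}$ satisfies $$\|\mathbb E_{\mu'}x\|^2>\max\Big\{\big(1+\tfrac{\varepsilon}{4}\big)\|\mathbb E_\mu x\|^2,\ \tfrac1{4\sqrt n}\Big\}.$$ (2) The same holds for pseudo-distributions. For a finitely supported $\mu:\mathbb R^n\to\mathbb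 R$ and a polynomial $f$ write $\tilde{\mathbb E}_\mu f=\sum_{x}\mu(x)f(x)$, and apply $\tilde{\mathbb E}_\mu$ to vectors and matrices of polynomials entrywise. Call $\mu$ a degree-$d$ pseudo-distribution over $\mathbb S^{n-1}$ if $\tilde{\mathbb E}_\mu 1=1$, $\tilde{\mathbb E}_\mu f^2\ge 0$ for every polynomial $f$ with $2\deg f\le d$, and $\tilde{\mathbb E}_\mu\big[(\|x\|^2-1)f\big]=0$ for every polynomial $f$ with $\deg f+2\le d$. If $d\ge k+2$ and $\mu$ is a degree-$d$ pseudo-distribution over $\mathbb S^{n-1}$ with $\varepsilon\|\tilde{\mathbb E}_\mu x\|^2<\|\tilde{\mathbb E}_\mu xx^{\top}-(\tilde{\mathbb E}_\mu x)(\tilde{\mathbb E}_\mu x)^{\top}\|_F$, then there is a sum-of-squares polynomial $p$ of degree at most $k$ with $\tilde{\mathbb E}_\mu p=1$ such that $\mu'=p\cdot\mu$ (the function $x\mapsto p(x)\mu(x)$) is a degree-$(d-k)$ pseudo-distribution over $\mathbb S^{n-1}$ and $\|\tilde{\mathbb E}_{\mu'}x\|^2>\max\big\{(1+\tfrac{\varepsilon}{4})\|\tilde{\mathbb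 E}_\mu x\|^2,\ \tfrac1{4\sqrt n}\big\}$. -/

import Mathlib

open MeasureTheory

noncomputable section

namespace SOSReweighting

/-- The Frobenius norm of a real square matrix. -/
def frobNorm {n : ℕ} (A : Matrix (Fin n) (Fin n) ℝ) : ℝ :=
  Real.sqrt (∑ i, ∑ j, A i j ^ 2)

/-- The value of a polynomial at a point of `ℝⁿ`. -/
def polyEval {n : ℕ} (p : MvPolynomial (Fin n) ℝ) (x : EuclideanSpace ℝ (Fin n)) : ℝ :=
  MvPolynomial.eval (fun i => x i) p

/-! ### Probability distributions on the sphere -/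

/-- `μ` is a probability distribution on the unit sphere of `ℝⁿ`. -/
def IsDistOnSphere {n : ℕ} (μ : Measure (EuclideanSpace ℝ (Fin n))) : Prop :=
  IsProbabilityMeasure μ ∧ ∀ᵐ x ∂μ, x ∈ Metric.sphere (0 : EuclideanSpace ℝ (Fin n)) 1

/-- The mean `E x` of a measure on `ℝⁿ`. -/
def mean {n : ℕ} (μ : Measure (EuclideanSpace ℝ (Fin n))) : EuclideanSpace ℝ (Fin n) :=
  ∫ x, x ∂μ

/-- The matrix `E xxᵀ` of a measure on `ℝⁿ`. -/
def secondMoment {n : ℕ} (μ : Measure (EuclideanSpace ℝ (Fin n))) :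
    Matrix (Fin n) (Fin n) ℝ :=
  Matrix.of fun i j => ∫ x, x i * x j ∂μ

/-- The reweighting `p · μ`, the measure with density `p` with respect to `μ`; it is used for
polynomials `p` that are nonnegative everywhere. -/
def reweight {n : ℕ} (μ : Measure (EuclideanSpace ℝ (Fin n))) (p : MvPolynomial (Fin n) ℝ) :
    Measure (EuclideanSpace ℝ (Fin n)) :=
  μ.withDensity fun x => ENNReal.ofReal (polyEval p x)

/-! ### Pseudo-distributions on the sphere -/

/-- The pseudo-expectation `∑ₓ μ(x) f(x)` of a polynomial with respect to a finitely supported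
real-valued function on `ℝⁿ`. -/
def pseudoExp {n : ℕ} (μ : EuclideanSpace ℝ (Fin n) →₀ ℝ) (f : MvPolynomial (Fin n) ℝ) : ℝ :=
  ∑ x ∈ μ.support, μ x * polyEval f x

/-- `μ` is a degree-`d` pseudo-distribution over `ℝⁿ`. -/
def IsPseudoDist {n : ℕ} (d : ℕ) (μ : EuclideanSpace ℝ (Fin n) →₀ ℝ) : Prop :=
  pseudoExp μ 1 = 1 ∧
    ∀ f : MvPolynomial (Fin n) ℝ, 2 * f.totalDegree ≤ d → 0 ≤ pseudoExp μ (f ^ 2)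

/-- `μ` is a degree-`d` pseudo-distribution over the unit sphere: it satisfies the constraint
`‖x‖² = 1` in every product of degree at most `d`. The support of `μ` need not lie on the
sphere. -/
def IsPseudoDistOnSphere {n : ℕ} (d : ℕ) (μ : EuclideanSpace ℝ (Fin n) →₀ ℝ) : Prop :=
  IsPseudoDist d μ ∧
    ∀ f : MvPolynomial (Fin n) ℝ, f.totalDegree + 2 ≤ d →
      pseudoExp μ ((∑ i, MvPolynomial.X i ^ 2 - 1) * f) = 0

/-- The vector `Ẽ x`. -/
def pseudoMean {n : ℕ} (μ : EuclideanSpace ℝ (Fin n) →₀ ℝ) : EuclideanSpace ℝ (Fin n) :=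
  WithLp.toLp 2 fun i => pseudoExp μ (MvPolynomial.X i)

/-- The matrix `Ẽ xxᵀ`. -/
def pseudoSecondMoment {n : ℕ} (μ : EuclideanSpace ℝ (Fin n) →₀ ℝ) :
    Matrix (Fin n) (Fin n) ℝ :=
  Matrix.of fun i j => pseudoExp μ (MvPolynomial.X i * MvPolynomial.X j)

/-- The reweighting `p · μ`, that is, the finitely supported function `x ↦ p(x) μ(x)`. -/
def pseudoReweight {n : ℕ} (μ : EuclideanSpace ℝ (Fin n) →₀ ℝ)
    (p : MvPolynomial (Fin n) ℝ) : EuclideanSpace ℝ (Fin n) →₀ ℝ :=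
  Finsupp.onFinset μ.support (fun x => polyEval p x * μ x) fun _ hx =>
    Finsupp.mem_support_iff.mpr (right_ne_zero_of_mul hx)

end SOSReweighting

end

/-! Write `L` for the (pseudo-)expectation, `M` for the squared norm of its mean, `F` for the
Frobenius norm of its covariance `S`, and `B` for the target maximum. It suffices to find a square
`h ^ 2` with `L (h ^ 2) = 1` and a unit `v` with `L (h ^ 2 * ⟨v, x⟩) > √B`.

Scalar case (`exists_sq_reweight_abs`): if `L (y ^ (2 * K)) > R ^ (2 * K)`, some square reweighting
gives `y` a mean exceeding `R` in absolute value; otherwise testing on `y ^ i * (R ± y)` bounds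
every even moment up to `2 * K`. So a direction with a large `2K`-th moment is needed.

Such a direction comes from `Q = ⟨e, x⟩² + ∑ ⟨a j, x⟩²`, where `e` is a unit vector along the mean
and the `a j` are short eigenvectors of `S` compressed to the complement of `e`, weighted so that `L
Q ≥ M + 3/8 * F` (`exists_orthogonal_family`). This exceeds `B` by a factor `1 + δ/10` with `δ = min
1 ε`, so for `K` a power of two, Cauchy–Schwarz makes `L (Q ^ K)` at least `((1 + δ/10) * B) ^ K`.
Conversely `Q ^ K` is, up to the Gaussian moment, the average of `⟨g, x⟩ ^ (2 * K)` over a Gaussian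
combination `g` of `e` and the `a j`. If no direction had a large moment, `L (Q ^ K)` would be at
most `B ^ K * exp (4 * ∑ c j)`, where `c j = ‖a j‖²` and `∑ c j = O(√n)` (`apply_quadratic_pow_le`).
For `K` a large multiple of `√n / δ` the two bounds contradict each other. -/

namespace SOSReweighting

open ProbabilityTheory

/-! ### One-dimensional Gaussian moments -/

/-- The `2k`-th moment of a standard Gaussian. -/
noncomputable def gaussMoment (k : ℕ) : ℝ := ∫ z, z ^ (2 * k) ∂(gaussianReal 0 1)

lemma integrable_pow_gaussianReal (k : ℕ) : Integrable (fun z : ℝ => z ^ k) (gaussianReal 0 1) := by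
  have h := (memLp_id_gaussianReal (μ := 0) (v := 1) (k : NNReal)).integrable_norm_pow'
  refine Integrable.mono' h (by fun_prop) (ae_of_all _ fun z => ?_)
  simp

lemma gaussMoment_zero : gaussMoment 0 = 1 := by
  simp [gaussMoment]

lemma gaussMoment_eq (k : ℕ) :
    gaussMoment k = (√(2 * Real.pi))⁻¹ * ∫ z : ℝ, z ^ (2 * k) * Real.exp (-(1 / 2) * z ^ 2) := by
  rw [gaussMoment, integral_gaussianReal_eq_integral_smul (by simp), ← integral_const_mul]
  congr 1
  ext z
  have : -z ^ 2 / 2 = -(1 / 2) * z ^ 2 := by ring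
  simp only [gaussianPDFReal, smul_eq_mul, sub_zero, NNReal.coe_one, mul_one, this]
  ring

lemma integrable_pow_mul_exp (k : ℕ) :
    Integrable (fun z : ℝ => z ^ k * Real.exp (-(1 / 2) * z ^ 2)) := by
  have h := integrable_rpow_mul_exp_neg_mul_sq (b := 1 / 2) (by norm_num) (s := (k : ℝ))
    (by have : (0 : ℝ) ≤ k := by positivity
        linarith)
  simpa using h

/-- Integration by parts against `z * exp (-z²/2)`, the derivative of `-exp (-z²/2)`. -/
lemma gaussMoment_succ (k : ℕ) : gaussMoment (k + 1) = (2 * k + 1) * gaussMoment k := by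
  have h := integral_mul_deriv_eq_deriv_mul_of_integrable
    (u := fun z : ℝ => z ^ (2 * k + 1)) (v := fun z : ℝ => -Real.exp (-(1 / 2) * z ^ 2))
    (u' := fun z : ℝ => ((2 * k + 1 : ℕ) : ℝ) * z ^ (2 * k))
    (v' := fun z : ℝ => z * Real.exp (-(1 / 2) * z ^ 2))
    (fun z _ => by simpa using hasDerivAt_pow (2 * k + 1) z)
    (fun z _ => by
      have := (((hasDerivAt_pow 2 z).const_mul (-(1 / 2 : ℝ))).exp).neg
      refine this.congr_deriv ?_
      simp
      ring)
    ((integrable_pow_mul_exp (2 * (k + 1))).congr (ae_of_all _ fun z => by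
      simp only [Pi.mul_apply]; ring))
    (((integrable_pow_mul_exp (2 * k)).const_mul (-((2 * k + 1 : ℕ) : ℝ))).congr
      (ae_of_all _ fun z => by simp only [Pi.mul_apply]; ring))
    ((integrable_pow_mul_exp (2 * k + 1)).neg.congr
      (ae_of_all _ fun z => by simp only [Pi.mul_apply, Pi.neg_apply]; ring))
  rw [gaussMoment_eq, gaussMoment_eq]
  have h1 : ∫ z : ℝ, z ^ (2 * (k + 1)) * Real.exp (-(1 / 2) * z ^ 2)
      = ∫ z : ℝ, z ^ (2 * k + 1) * (z * Real.exp (-(1 / 2) * z ^ 2)) := by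
    congr 1; ext z; ring
  have h2 : ∫ z : ℝ, ((2 * k + 1 : ℕ) : ℝ) * z ^ (2 * k) * -Real.exp (-(1 / 2) * z ^ 2)
      = -((2 * k + 1 : ℕ) : ℝ) * ∫ z : ℝ, z ^ (2 * k) * Real.exp (-(1 / 2) * z ^ 2) := by
    rw [← integral_const_mul]; congr 1; ext z; ring
  rw [h1, h, h2]
  push_cast
  ring

lemma gaussMoment_pos (k : ℕ) : 0 < gaussMoment k := by
  induction k with
  | zero => simp [gaussMoment_zero]
  | succ k ih => rw [gaussMoment_succ]; positivity

/-- Each step of the recursion contributes `2 * i + 1 ≥ i + 1`. This turns a binomial expansion of a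
moment into a truncated exponential series. -/
lemma descFactorial_mul_gaussMoment_le {j k : ℕ} (hjk : j ≤ k) :
    (k.descFactorial j : ℝ) * gaussMoment (k - j) ≤ gaussMoment k := by
  induction j with
  | zero => simp
  | succ j ih =>
    refine le_trans ?_ (ih (by omega))
    obtain ⟨i, rfl⟩ : ∃ i, k = j + 1 + i := ⟨k - (j + 1), by omega⟩
    have e1 : j + 1 + i - (j + 1) = i := by omega
    have e2 : j + 1 + i - j = i + 1 := by omega
    rw [Nat.descFactorial_succ, e1, e2, gaussMoment_succ]
    push_cast
    have := gaussMoment_pos i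
    have h : ((i : ℝ) + 1) * gaussMoment i ≤ (2 * i + 1) * gaussMoment i := by
      apply mul_le_mul_of_nonneg_right _ this.le
      have : (0 : ℝ) ≤ i := by positivity
      linarith
    calc ((i : ℝ) + 1) * ((j + 1 + i).descFactorial j) * gaussMoment i
        = ((j + 1 + i).descFactorial j) * (((i : ℝ) + 1) * gaussMoment i) := by ring
      _ ≤ _ := by gcongr

lemma integrable_exp_mul_sq_gaussianReal {c : ℝ} (hc : c < 1 / 2) :
    Integrable (fun z : ℝ => Real.exp (c * z ^ 2)) (gaussianReal 0 1) := by
  rw [gaussianReal_of_var_ne_zero _ (by simp), integrable_withDensity_iff_integrable_smul₀'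
    (measurable_gaussianPDF _ _).aemeasurable (ae_of_all _ fun _ => gaussianPDF_lt_top)]
  refine ((integrable_exp_neg_mul_sq (b := 1 / 2 - c) (by linarith)).const_mul
    (√(2 * Real.pi))⁻¹).congr (ae_of_all _ fun z => ?_)
  simp only [toReal_gaussianPDF, gaussianPDFReal, smul_eq_mul]
  rw [mul_assoc, ← Real.exp_add]
  simp only [sub_zero, NNReal.coe_one, mul_one]
  ring_nf

lemma integral_exp_mul_sq_gaussianReal_le {c : ℝ} (h0 : 0 ≤ c) (hc : c ≤ 3 / 8) :
    ∫ z : ℝ, Real.exp (c * z ^ 2) ∂(gaussianReal 0 1) ≤ Real.exp (4 * c) := by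
  have e : ∫ z : ℝ, Real.exp (c * z ^ 2) ∂(gaussianReal 0 1) =
      (√(2 * Real.pi))⁻¹ * √(Real.pi / (1 / 2 - c)) := by
    rw [integral_gaussianReal_eq_integral_smul (by simp), ← integral_gaussian,
      ← integral_const_mul]
    congr 1
    ext z
    simp only [gaussianPDFReal, smul_eq_mul]
    rw [mul_assoc, ← Real.exp_add]
    simp only [sub_zero, NNReal.coe_one, mul_one]
    ring_nf
  rw [e]
  have h1 : (0 : ℝ) < 1 / 2 - c := by linarith
  have hpi := Real.pi_pos
  rw [← Real.sqrt_inv, ← Real.sqrt_mul (by positivity)]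
  apply Real.sqrt_le_iff.2 ⟨by positivity, ?_⟩
  rw [← Real.exp_nat_mul]
  have h2 : (2 * Real.pi)⁻¹ * (Real.pi / (1 / 2 - c)) = 1 / (1 - 2 * c) := by
    have : (1 : ℝ) - 2 * c ≠ 0 := by linarith
    field_simp
  rw [h2, div_le_iff₀ (by linarith)]
  have h3 := Real.add_one_le_exp (((2 : ℕ) : ℝ) * (4 * c))
  push_cast at h3 ⊢
  -- With `exp (8c) ≥ 1 + 8c` it remains to see `(1 - 2c)(1 + 8c) ≥ 1`, which for `c ≥ 0` holds
  -- exactly when `c ≤ 3/8`; this is the source of the constant `3/8` throughout.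
  nlinarith

/-! ### Gaussian vectors: linear forms and quadratic forms -/

section Multivariate

variable {m : ℕ}

/-- The law of `m + 1` independent standard Gaussians, the first one being singled out. -/
noncomputable def gaussProd (m : ℕ) : Measure (ℝ × (Fin m → ℝ)) :=
  (gaussianReal 0 1).prod (Measure.pi fun _ => gaussianReal 0 1)

instance : IsProbabilityMeasure (gaussProd m) := by unfold gaussProd; infer_instance

lemma map_pi_gaussian_linear (s : Fin m → ℝ) :
    (Measure.pi fun _ : Fin m => gaussianReal 0 1).map (fun z => ∑ j, s j * z j)
      = gaussianReal 0 (∑ j, s j ^ 2).toNNReal := by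
  apply Measure.ext_of_charFun
  ext t
  rw [charFun_gaussianReal, charFun_apply_real, integral_map
    (by fun_prop : Measurable fun z : Fin m → ℝ => ∑ j, s j * z j).aemeasurable (by fun_prop)]
  simp_rw [Complex.ofReal_sum, Finset.mul_sum, Finset.sum_mul, Complex.exp_sum]
  rw [integral_fintype_prod_eq_prod
    (f := fun j x => Complex.exp ((t : ℂ) * ((s j * x : ℝ) : ℂ) * Complex.I))]
  have h : ∀ j, ∫ x, Complex.exp ((t : ℂ) * ((s j * x : ℝ) : ℂ) * Complex.I) ∂(gaussianReal 0 1)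
      = Complex.exp (-((t * s j) ^ 2 / 2 : ℝ)) := by
    intro j
    have := charFun_gaussianReal (μ := 0) (v := 1) (t * s j)
    rw [charFun_apply_real] at this
    convert this using 1
    · congr 1; ext x; push_cast; ring_nf
    · simp
  simp_rw [h]
  rw [← Complex.exp_sum, Real.coe_toNNReal _ (Finset.sum_nonneg fun _ _ => sq_nonneg _)]
  congr 1
  push_cast
  simp only [mul_pow, mul_zero, zero_mul, zero_sub, Finset.sum_neg_distrib]
  rw [← Finset.sum_div, ← Finset.mul_sum]
  ring

lemma map_gaussProd_linear (t : ℝ) (s : Fin m → ℝ) :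
    (gaussProd m).map (fun ω => t * ω.1 + ∑ j, s j * ω.2 j)
      = gaussianReal 0 (t ^ 2 + ∑ j, s j ^ 2).toNNReal := by
  have h1 : (gaussianReal 0 1).map (fun x => t * x) = gaussianReal 0 (t ^ 2).toNNReal := by
    rw [gaussianReal_map_const_mul]
    congr 1
    · simp
    · ext; simp [Real.coe_toNNReal _ (sq_nonneg t)]
  have h2 := gaussianReal_conv_gaussianReal (m₁ := 0) (m₂ := 0) (v₁ := (t ^ 2).toNNReal)
    (v₂ := (∑ j, s j ^ 2).toNNReal)
  rw [← Real.toNNReal_add (sq_nonneg _) (Finset.sum_nonneg fun _ _ => sq_nonneg _), add_zero,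
    ← h1, ← map_pi_gaussian_linear, Measure.conv, Measure.map_prod_map _ _ (by fun_prop)
    (by fun_prop), Measure.map_map (by fun_prop) (by fun_prop)] at h2
  exact h2

lemma integral_gaussProd_linear_pow (k : ℕ) (t : ℝ) (s : Fin m → ℝ) :
    ∫ ω, (t * ω.1 + ∑ j, s j * ω.2 j) ^ (2 * k) ∂(gaussProd m)
      = gaussMoment k * (t ^ 2 + ∑ j, s j ^ 2) ^ k := by
  have hnn : 0 ≤ t ^ 2 + ∑ j, s j ^ 2 := by positivity
  have h1 : ∫ ω, (t * ω.1 + ∑ j, s j * ω.2 j) ^ (2 * k) ∂(gaussProd m)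
      = ∫ x, x ^ (2 * k) ∂((gaussProd m).map (fun ω => t * ω.1 + ∑ j, s j * ω.2 j)) := by
    rw [integral_map (by fun_prop) (by fun_prop)]
  have h2 : gaussianReal 0 (t ^ 2 + ∑ j, s j ^ 2).toNNReal
      = (gaussianReal 0 1).map (fun x => √(t ^ 2 + ∑ j, s j ^ 2) * x) := by
    rw [gaussianReal_map_const_mul]
    congr 1
    · simp
    · ext; simp [Real.sq_sqrt hnn, Real.coe_toNNReal _ hnn]
  rw [h1, map_gaussProd_linear, h2, integral_map (by fun_prop) (by fun_prop)]
  simp_rw [mul_pow]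
  rw [integral_const_mul, pow_mul, Real.sq_sqrt hnn, gaussMoment, mul_comm]

lemma integrable_gaussProd_monomial (a : ℕ) (κ : Fin m → ℕ) :
    Integrable (fun ω : ℝ × (Fin m → ℝ) => ω.1 ^ a * ∏ j, ω.2 j ^ κ j) (gaussProd m) :=
  Integrable.mul_prod (integrable_pow_gaussianReal a)
    (Integrable.fintype_prod (f := fun j (x : ℝ) => x ^ κ j)
      fun j => integrable_pow_gaussianReal (κ j))

variable {c : Fin m → ℝ}

lemma integrable_exp_quadratic (hc : ∀ j, c j ≤ 3 / 8) :
    Integrable (fun z : Fin m → ℝ => Real.exp (∑ j, c j * z j ^ 2))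
      (Measure.pi fun _ => gaussianReal 0 1) := by
  simp_rw [Real.exp_sum]
  exact Integrable.fintype_prod (f := fun j (x : ℝ) => Real.exp (c j * x ^ 2))
      fun j => integrable_exp_mul_sq_gaussianReal (by linarith [hc j])

lemma integral_exp_quadratic_le (h0 : ∀ j, 0 ≤ c j) (hc : ∀ j, c j ≤ 3 / 8) :
    ∫ z : Fin m → ℝ, Real.exp (∑ j, c j * z j ^ 2) ∂(Measure.pi fun _ => gaussianReal 0 1)
      ≤ Real.exp (4 * ∑ j, c j) := by
  simp_rw [Real.exp_sum, Finset.mul_sum, Real.exp_sum]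
  rw [integral_fintype_prod_eq_prod (f := fun j (x : ℝ) => Real.exp (c j * x ^ 2))]
  exact Finset.prod_le_prod (fun j _ => integral_nonneg fun _ => (Real.exp_pos _).le)
    fun j _ => integral_exp_mul_sq_gaussianReal_le (h0 j) (hc j)

lemma integrable_quadratic_pow (h0 : ∀ j, 0 ≤ c j) (hc : ∀ j, c j ≤ 3 / 8) (i : ℕ) :
    Integrable (fun z : Fin m → ℝ => (∑ j, c j * z j ^ 2) ^ i)
      (Measure.pi fun _ => gaussianReal 0 1) := by
  refine Integrable.mono' ((integrable_exp_quadratic hc).const_mul (i.factorial : ℝ))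
    (by fun_prop : Continuous fun z : Fin m → ℝ => (∑ j, c j * z j ^ 2) ^ i).aestronglyMeasurable
    (ae_of_all _ fun z => ?_)
  have hW : 0 ≤ ∑ j, c j * z j ^ 2 :=
    Finset.sum_nonneg fun j _ => mul_nonneg (h0 j) (sq_nonneg _)
  rw [Real.norm_of_nonneg (by positivity)]
  have := Real.pow_div_factorial_le_exp _ hW i
  rw [div_le_iff₀ (by positivity)] at this
  linarith

lemma integrable_gaussProd_sq_add_quadratic_pow (h0 : ∀ j, 0 ≤ c j) (hc : ∀ j, c j ≤ 3 / 8)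
    (k : ℕ) :
    Integrable (fun ω : ℝ × (Fin m → ℝ) => (ω.1 ^ 2 + ∑ j, c j * ω.2 j ^ 2) ^ k)
      (gaussProd m) := by
  simp_rw [add_pow]
  refine integrable_finsetSum _ fun i _ => Integrable.mul_const ?_ _
  exact Integrable.mul_prod (f := fun z : ℝ => (z ^ 2) ^ i)
    (by simpa [← pow_mul] using integrable_pow_gaussianReal (2 * i))
    (integrable_quadratic_pow h0 hc _)

/-- With `W` the quadratic form in the remaining variables, the `i`-th binomial term averages to at
most `gaussMoment k` times the mean of `W ^ i / i!`. Summing gives at most `exp W`, whose mean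
factors over coordinates. The factor `gaussMoment k` is what the averaging identity later cancels.
-/
lemma integral_gaussProd_sq_add_quadratic_pow_le (h0 : ∀ j, 0 ≤ c j) (hc : ∀ j, c j ≤ 3 / 8)
    (k : ℕ) :
    ∫ ω, (ω.1 ^ 2 + ∑ j, c j * ω.2 j ^ 2) ^ k ∂(gaussProd m)
      ≤ gaussMoment k * Real.exp (4 * ∑ j, c j) := by
  have hW : ∀ z : Fin m → ℝ, 0 ≤ ∑ j, c j * z j ^ 2 := fun z =>
    Finset.sum_nonneg fun j _ => mul_nonneg (h0 j) (sq_nonneg _)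
  have hint : ∀ i, Integrable (fun ω : ℝ × (Fin m → ℝ) =>
      (∑ j, c j * ω.2 j ^ 2) ^ i * (ω.1 ^ 2) ^ (k - i) * (k.choose i : ℝ)) (gaussProd m) := by
    intro i
    refine Integrable.mul_const ?_ _
    have := Integrable.mul_prod (f := fun z : ℝ => (z ^ 2) ^ (k - i))
      (by simpa [← pow_mul] using integrable_pow_gaussianReal (2 * (k - i)))
      (integrable_quadratic_pow h0 hc i)
    refine this.congr (ae_of_all _ fun ω => by simp only []; ring)
  have hterm : ∀ i ∈ Finset.range (k + 1), ∫ ω, (∑ j, c j * ω.2 j ^ 2) ^ i *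
      (ω.1 ^ 2) ^ (k - i) * (k.choose i : ℝ) ∂(gaussProd m) ≤
      gaussMoment k * ∫ z : Fin m → ℝ, (∑ j, c j * z j ^ 2) ^ i / (i.factorial : ℝ)
        ∂(Measure.pi fun _ => gaussianReal 0 1) := by
    intro i hi
    have hik : i ≤ k := by simpa [Nat.lt_succ_iff] using hi
    have e : ∫ ω, (∑ j, c j * ω.2 j ^ 2) ^ i * (ω.1 ^ 2) ^ (k - i) * (k.choose i : ℝ)
        ∂(gaussProd m) = (gaussMoment (k - i) * ∫ z : Fin m → ℝ, (∑ j, c j * z j ^ 2) ^ i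
        ∂(Measure.pi fun _ => gaussianReal 0 1)) * (k.choose i : ℝ) := by
      rw [integral_mul_const, gaussMoment, ← integral_prod_mul]
      congr 2
      ext ω
      rw [pow_mul]
      ring
    rw [e, integral_div]
    set I := ∫ z : Fin m → ℝ, (∑ j, c j * z j ^ 2) ^ i ∂(Measure.pi fun _ => gaussianReal 0 1)
    have hI : 0 ≤ I := integral_nonneg fun z => pow_nonneg (hW z) _
    have h1 := descFactorial_mul_gaussMoment_le hik
    rw [Nat.descFactorial_eq_factorial_mul_choose] at h1
    push_cast at h1
    have hf : (0 : ℝ) < i.factorial := by positivity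
    rw [mul_div_assoc', le_div_iff₀ hf]
    calc gaussMoment (k - i) * I * (k.choose i : ℝ) * i.factorial
        = ((i.factorial : ℝ) * k.choose i * gaussMoment (k - i)) * I := by ring
      _ ≤ gaussMoment k * I := by gcongr
  calc ∫ ω, (ω.1 ^ 2 + ∑ j, c j * ω.2 j ^ 2) ^ k ∂(gaussProd m)
      = ∑ i ∈ Finset.range (k + 1), ∫ ω, (∑ j, c j * ω.2 j ^ 2) ^ i *
          (ω.1 ^ 2) ^ (k - i) * (k.choose i : ℝ) ∂(gaussProd m) := by
        rw [← integral_finsetSum _ fun i _ => hint i]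
        congr 1
        ext ω
        rw [add_comm, add_pow]
    _ ≤ ∑ i ∈ Finset.range (k + 1), gaussMoment k *
          ∫ z : Fin m → ℝ, (∑ j, c j * z j ^ 2) ^ i / (i.factorial : ℝ)
            ∂(Measure.pi fun _ => gaussianReal 0 1) := Finset.sum_le_sum hterm
    _ = gaussMoment k * ∫ z : Fin m → ℝ, ∑ i ∈ Finset.range (k + 1),
          (∑ j, c j * z j ^ 2) ^ i / (i.factorial : ℝ)
            ∂(Measure.pi fun _ => gaussianReal 0 1) := by
        rw [integral_finsetSum _ fun i _ => (integrable_quadratic_pow h0 hc i).div_const _,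
          Finset.mul_sum]
    _ ≤ gaussMoment k * ∫ z : Fin m → ℝ, Real.exp (∑ j, c j * z j ^ 2)
            ∂(Measure.pi fun _ => gaussianReal 0 1) := by
        refine mul_le_mul_of_nonneg_left (integral_mono ?_ (integrable_exp_quadratic hc) ?_)
          (gaussMoment_pos k).le
        · exact integrable_finsetSum _ fun i _ => (integrable_quadratic_pow h0 hc i).div_const _
        · exact fun z => Real.sum_le_exp_of_nonneg (hW z) _
    _ ≤ _ := mul_le_mul_of_nonneg_left (integral_exp_quadratic_le h0 hc) (gaussMoment_pos k).le

end Multivariate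

open MvPolynomial

/-! ### Averaging a linear functional over Gaussian directions -/

section Averaging

variable {n m : ℕ}

/-- The linear form `⟨v, x⟩` as a polynomial in `x`. -/
noncomputable def linForm (v : Fin n → ℝ) : MvPolynomial (Fin n) ℝ := ∑ i, v i • X i

lemma totalDegree_linForm_le (v : Fin n → ℝ) : (linForm v).totalDegree ≤ 1 :=
  totalDegree_finsetSum_le fun i _ => (totalDegree_smul_le _ _).trans (by simp)

lemma linForm_add (v w : Fin n → ℝ) : linForm (v + w) = linForm v + linForm w := by
  simp [linForm, add_smul, Finset.sum_add_distrib]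

lemma linForm_smul (r : ℝ) (v : Fin n → ℝ) : linForm (r • v) = r • linForm v := by
  simp [linForm, Finset.smul_sum, mul_smul]

lemma linForm_sum (a : Fin m → Fin n → ℝ) : linForm (∑ j, a j) = ∑ j, linForm (a j) := by
  simp only [linForm, Finset.sum_apply, Finset.sum_smul]
  exact Finset.sum_comm

lemma linForm_neg (v : Fin n → ℝ) : linForm (-v) = -linForm v := by
  simp [linForm]

variable (L : MvPolynomial (Fin n) ℝ →ₗ[ℝ] ℝ) (q₀ : MvPolynomial (Fin n) ℝ)
  (q : Fin m → MvPolynomial (Fin n) ℝ)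

lemma gaussComb_pow_eq_sum (N : ℕ) (ω : ℝ × (Fin m → ℝ)) :
    (ω.1 • q₀ + ∑ j, ω.2 j • q j) ^ N =
      ∑ κ ∈ (Finset.univ : Finset (Option (Fin m))).piAntidiag N,
        (ω.1 ^ κ none * ∏ j, ω.2 j ^ κ (some j)) •
          ((Nat.multinomial Finset.univ κ : MvPolynomial (Fin n) ℝ) *
            (q₀ ^ κ none * ∏ j, q j ^ κ (some j))) := by
  have h := Finset.sum_pow_eq_sum_piAntidiag (Finset.univ : Finset (Option (Fin m)))
    (fun o => o.elim (ω.1 • q₀) (fun j => ω.2 j • q j)) N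
  simp only [Fintype.sum_option, Fintype.prod_option, Option.elim] at h
  rw [h]
  refine Finset.sum_congr rfl fun κ _ => ?_
  simp only [smul_eq_C_mul, mul_pow, Finset.prod_mul_distrib, map_mul, map_pow, map_prod]
  ring

lemma integrable_apply_gaussComb_pow (N : ℕ) :
    Integrable (fun ω => L ((ω.1 • q₀ + ∑ j, ω.2 j • q j) ^ N)) (gaussProd m) := by
  simp only [gaussComb_pow_eq_sum, map_sum, map_smul, smul_eq_mul]
  exact integrable_finsetSum _ fun κ _ => (integrable_gaussProd_monomial _ _).mul_const _

lemma integral_apply_gaussComb_pow (k : ℕ) :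
    ∫ ω, L ((ω.1 • q₀ + ∑ j, ω.2 j • q j) ^ (2 * k)) ∂(gaussProd m) =
      gaussMoment k * L ((q₀ ^ 2 + ∑ j, q j ^ 2) ^ k) := by
  -- The polynomial inside `T` on the right does not depend on `T`. Taking `T` to be evaluation at
  -- each point identifies it, and the identity then transfers to `L`, which need not come from a
  -- measure.
  have key : ∀ T : MvPolynomial (Fin n) ℝ →ₗ[ℝ] ℝ,
      ∫ ω, T ((ω.1 • q₀ + ∑ j, ω.2 j • q j) ^ (2 * k)) ∂(gaussProd m) =
      T (∑ κ ∈ (Finset.univ : Finset (Option (Fin m))).piAntidiag (2 * k),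
        (∫ ω, ω.1 ^ κ none * ∏ j, ω.2 j ^ κ (some j) ∂(gaussProd m)) •
          ((Nat.multinomial Finset.univ κ : MvPolynomial (Fin n) ℝ) *
            (q₀ ^ κ none * ∏ j, q j ^ κ (some j)))) := by
    intro T
    simp only [gaussComb_pow_eq_sum, map_sum, map_smul, smul_eq_mul]
    rw [integral_finsetSum _ fun κ _ => (integrable_gaussProd_monomial _ _).mul_const _]
    simp only [integral_mul_const]
  rw [key, ← smul_eq_mul (gaussMoment k), ← map_smul]
  congr 1
  apply MvPolynomial.funext
  intro x
  have hx := key (MvPolynomial.aeval (R := ℝ) x).toLinearMap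
  simp only [AlgHom.toLinearMap_apply, aeval_eq_eval] at hx
  rw [← hx]
  have h := integral_gaussProd_linear_pow k (eval x q₀) (fun j => eval x (q j))
  simp only [map_pow, map_add, map_sum, smul_eval] at *
  rw [← h]
  congr 1
  ext ω
  simp only [mul_comm]

/-- If a functional satisfies `L ⟨v, x⟩²ᵏ ≤ B ‖v‖²ᵏ` for all directions `v`, then averaging over
a Gaussian direction bounds the `k`-th moment of a quadratic form. -/
lemma apply_quadratic_pow_le {k : ℕ} {B : ℝ} (hB : 0 ≤ B)
    (hL : ∀ v : Fin n → ℝ, L (linForm v ^ (2 * k)) ≤ B * (v ⬝ᵥ v) ^ k)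
    {e : Fin n → ℝ} {a : Fin m → Fin n → ℝ} {c : Fin m → ℝ} (he : e ⬝ᵥ e = 1)
    (hea : ∀ j, e ⬝ᵥ a j = 0) (haa : ∀ i j, a i ⬝ᵥ a j = if i = j then c i else 0)
    (h0 : ∀ j, 0 ≤ c j) (hc : ∀ j, c j ≤ 3 / 8) :
    L ((linForm e ^ 2 + ∑ j, linForm (a j) ^ 2) ^ k) ≤ B * Real.exp (4 * ∑ j, c j) := by
  have hnorm : ∀ ω : ℝ × (Fin m → ℝ), (ω.1 • e + ∑ j, ω.2 j • a j) ⬝ᵥ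
      (ω.1 • e + ∑ j, ω.2 j • a j) = ω.1 ^ 2 + ∑ j, c j * ω.2 j ^ 2 := by
    intro ω
    simp only [add_dotProduct, dotProduct_add, smul_dotProduct, dotProduct_smul, he,
      sum_dotProduct, dotProduct_sum, hea, haa, smul_eq_mul, mul_zero, Finset.sum_const_zero,
      dotProduct_comm _ e]
    simp
    rw [sq]
    congr 1
    exact Finset.sum_congr rfl fun j _ => by ring
  have h1 := integral_apply_gaussComb_pow L (linForm e) (fun j => linForm (a j)) k
  have h2 : ∫ ω, L ((ω.1 • linForm e + ∑ j, ω.2 j • linForm (a j)) ^ (2 * k)) ∂(gaussProd m)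
      ≤ ∫ ω, B * (ω.1 ^ 2 + ∑ j, c j * ω.2 j ^ 2) ^ k ∂(gaussProd m) := by
    refine integral_mono (integrable_apply_gaussComb_pow _ _ _ _)
      ((integrable_gaussProd_sq_add_quadratic_pow h0 hc k).const_mul B) fun ω => ?_
    have := hL (ω.1 • e + ∑ j, ω.2 j • a j)
    rw [hnorm, linForm_add, linForm_smul, linForm_sum] at this
    simpa only [linForm_smul] using this
  rw [h1, integral_const_mul] at h2
  have h3 := mul_le_mul_of_nonneg_left (integral_gaussProd_sq_add_quadratic_pow_le h0 hc k) hB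
  have hpos := gaussMoment_pos k
  refine le_of_mul_le_mul_left ?_ hpos
  linarith

end Averaging

/-! ### Pseudo-expectations and reweighting by squares -/

section PseudoExpectation

variable {n d : ℕ}

lemma linearMap_C_mul (L : MvPolynomial (Fin n) ℝ →ₗ[ℝ] ℝ) (r : ℝ) (f : MvPolynomial (Fin n) ℝ) :
    L (C r * f) = r * L f := by
  rw [← smul_eq_C_mul, map_smul, smul_eq_mul]

/-- A linear functional on polynomials that is normalised and nonnegative on squares of degree at
most `d`. -/
structure IsPseudoExpectation (d : ℕ) (L : MvPolynomial (Fin n) ℝ →ₗ[ℝ] ℝ) : Prop where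
  map_one : L 1 = 1
  sq_nonneg : ∀ f : MvPolynomial (Fin n) ℝ, 2 * f.totalDegree ≤ d → 0 ≤ L (f ^ 2)

namespace IsPseudoExpectation

variable {L : MvPolynomial (Fin n) ℝ →ₗ[ℝ] ℝ}

lemma cauchy_schwarz (hL : IsPseudoExpectation d L) {f g : MvPolynomial (Fin n) ℝ}
    (hf : 2 * f.totalDegree ≤ d) (hg : 2 * g.totalDegree ≤ d) :
    L (f * g) ^ 2 ≤ L (f ^ 2) * L (g ^ 2) := by
  have h : ∀ t : ℝ, 0 ≤ L (g ^ 2) * (t * t) + 2 * L (f * g) * t + L (f ^ 2) := by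
    intro t
    have hd : 2 * (f + t • g).totalDegree ≤ d := by
      have h1 := totalDegree_add f (t • g)
      have h2 := totalDegree_smul_le t g
      have h3 : max f.totalDegree (t • g).totalDegree ≤ max f.totalDegree g.totalDegree :=
        max_le_max le_rfl h2
      rcases max_cases f.totalDegree g.totalDegree with h | h <;> omega
    have h0 := hL.sq_nonneg _ hd
    have e : (f + t • g) ^ 2 = f ^ 2 + (2 * t) • (f * g) + (t * t) • g ^ 2 := by
      simp only [smul_eq_C_mul, map_mul, map_ofNat]
      ring
    rw [e] at h0
    simp only [map_add, map_smul, smul_eq_mul] at h0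
    linarith
  have := discrim_le_zero h
  rw [discrim] at this
  nlinarith

/-- Jensen's inequality by repeated Cauchy–Schwarz against `1`; each use doubles the exponent, hence
powers of two. -/
lemma pow_two_pow_le (hL : IsPseudoExpectation d L) {f : MvPolynomial (Fin n) ℝ}
    (h0 : 0 ≤ L f) (q : ℕ) (hd : 2 ^ q * f.totalDegree ≤ d) : L f ^ (2 ^ q) ≤ L (f ^ (2 ^ q)) := by
  induction q with
  | zero => simp
  | succ q ih =>
    have hd' : 2 ^ q * f.totalDegree ≤ d :=
      le_trans (Nat.mul_le_mul_right _ (Nat.pow_le_pow_right (by norm_num) (by omega))) hd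
    have h1 := ih hd'
    have h2 := hL.cauchy_schwarz (f := f ^ (2 ^ q)) (g := 1)
      (by have := totalDegree_pow f (2 ^ q); rw [pow_succ] at hd; nlinarith) (by simp)
    rw [mul_one, one_pow, hL.map_one, mul_one, ← pow_mul, ← pow_succ] at h2
    calc L f ^ (2 ^ (q + 1)) = (L f ^ (2 ^ q)) ^ 2 := by rw [← pow_mul, ← pow_succ]
      _ ≤ L (f ^ (2 ^ q)) ^ 2 := by gcongr
      _ ≤ _ := h2

/-- A scalar polynomial with a large even moment can be given a large mean, up to sign, by
reweighting with a square. -/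
lemma exists_sq_reweight_abs (hL : IsPseudoExpectation d L) {k : ℕ} {R : ℝ}
    (hR : 0 < R) {y : MvPolynomial (Fin n) ℝ}
    (hy : y.totalDegree ≤ 1) (hd : 2 * k + 2 ≤ d) (hmom : R ^ (2 * k) < L (y ^ (2 * k))) :
    ∃ h : MvPolynomial (Fin n) ℝ, h.totalDegree ≤ k ∧ L (h ^ 2) = 1 ∧ R < |L (h ^ 2 * y)| := by
  by_contra! H
  have step : ∀ h : MvPolynomial (Fin n) ℝ, h.totalDegree ≤ k →
      |L (h ^ 2 * y)| ≤ R * L (h ^ 2) := by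
    intro h hh
    have h0 : 0 ≤ L (h ^ 2) := hL.sq_nonneg h (by omega)
    -- If `L (h ^ 2) = 0` no normalisation is possible, but Cauchy–Schwarz on `h` and `h * y` forces
    -- `L (h ^ 2 * y) = 0`; this is where degree `2 * k + 2` is needed.
    rcases h0.eq_or_lt with h0 | h0
    · have h1 := totalDegree_mul h y
      have := hL.cauchy_schwarz (f := h) (g := h * y) (by omega) (by omega)
      rw [← h0, zero_mul] at this
      have h2 : L (h * (h * y)) = 0 := by
        apply pow_eq_zero_iff (two_ne_zero) |>.1
        exact le_antisymm this (_root_.sq_nonneg _)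
      have e : h ^ 2 * y = h * (h * y) := by ring
      rw [e, h2, ← h0]
      simp
    · have h1 : (C (√(L (h ^ 2)))⁻¹ * h) ^ 2 = C (L (h ^ 2))⁻¹ * h ^ 2 := by
        rw [mul_pow, ← map_pow, inv_pow, Real.sq_sqrt h0.le]
      have h2 : (C (√(L (h ^ 2)))⁻¹ * h).totalDegree ≤ k := by
        have := totalDegree_mul (C (√(L (h ^ 2)))⁻¹) h
        simp only [totalDegree_C, zero_add] at this
        exact this.trans hh
      have h3 := H _ h2 (by rw [h1, linearMap_C_mul, inv_mul_cancel₀ h0.ne'])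
      rw [h1, mul_assoc, linearMap_C_mul, abs_mul, abs_of_pos (inv_pos.2 h0),
        inv_mul_le_iff₀ h0] at h3
      linarith
  have mono : ∀ i < k, L (y ^ (2 * (i + 1))) ≤ R ^ 2 * L (y ^ (2 * i)) := by
    intro i hi
    have hdeg : ∀ s : ℝ, (y ^ i * (C R + C s * y)).totalDegree ≤ k := by
      intro s
      have h1 := totalDegree_mul (y ^ i) (C R + C s * y)
      have h2 := totalDegree_pow y i
      have h3 := totalDegree_add (C R) (C s * y)
      have h4 := totalDegree_mul (C s) y
      simp only [totalDegree_C] at h3 h4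
      have h5 : i * y.totalDegree ≤ i * 1 := Nat.mul_le_mul_left _ hy
      omega
    have hp := (abs_le.1 (step _ (hdeg 1))).2
    have hm := (abs_le.1 (step _ (hdeg (-1)))).1
    have e1 : ∀ s : ℝ, L ((y ^ i * (C R + C s * y)) ^ 2) =
        R ^ 2 * L (y ^ (2 * i)) + 2 * R * s * L (y ^ (2 * i + 1)) +
          s ^ 2 * L (y ^ (2 * (i + 1))) := by
      intro s
      rw [← linearMap_C_mul, ← linearMap_C_mul, ← linearMap_C_mul, ← map_add, ← map_add]
      congr 1
      simp only [map_mul, map_pow, map_ofNat]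
      ring
    have e2 : ∀ s : ℝ, L ((y ^ i * (C R + C s * y)) ^ 2 * y) =
        R ^ 2 * L (y ^ (2 * i + 1)) + 2 * R * s * L (y ^ (2 * (i + 1))) +
          s ^ 2 * L (y ^ (2 * (i + 1) + 1)) := by
      intro s
      rw [← linearMap_C_mul, ← linearMap_C_mul, ← linearMap_C_mul, ← map_add, ← map_add]
      congr 1
      simp only [map_mul, map_pow, map_ofNat]
      ring
    rw [e1, e2] at hp hm
    -- Adding the two tests cancels the odd moments: `(R + y)²(R - y) + (R - y)²(R + y) = 2R(R² -
    -- y²)`.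
    refine le_of_mul_le_mul_left ?_ (show 0 < 2 * R by positivity)
    nlinarith
  have all : ∀ i ≤ k, L (y ^ (2 * i)) ≤ R ^ (2 * i) := by
    intro i
    induction i with
    | zero => simp [hL.map_one]
    | succ i ih =>
      intro hi
      calc _ ≤ R ^ 2 * L (y ^ (2 * i)) := mono i hi
        _ ≤ R ^ 2 * R ^ (2 * i) := by gcongr; exact ih (by omega)
        _ = _ := by ring
  exact absurd (all k le_rfl) (not_le.2 hmom)

/-- A quadratic form `⟨e, x⟩² + ∑ ⟨aⱼ, x⟩²` with large expectation, where the `aⱼ` are short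
compared to the unit vector `e`, yields a reweighting with a large mean in some direction. -/
lemma exists_sq_reweight (hL : IsPseudoExpectation d L) {m q : ℕ} {R : ℝ}
    (hR : 0 < R) (hd : 2 * 2 ^ q + 2 ≤ d)
    {e : Fin n → ℝ} {a : Fin m → Fin n → ℝ} {c : Fin m → ℝ} (he : e ⬝ᵥ e = 1)
    (hea : ∀ j, e ⬝ᵥ a j = 0) (haa : ∀ i j, a i ⬝ᵥ a j = if i = j then c i else 0)
    (h0 : ∀ j, 0 ≤ c j) (hc : ∀ j, c j ≤ 3 / 8)
    (hlarge : (R ^ 2) ^ (2 ^ q) * Real.exp (4 * ∑ j, c j) <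
      L (linForm e ^ 2 + ∑ j, linForm (a j) ^ 2) ^ (2 ^ q)) :
    ∃ (h : MvPolynomial (Fin n) ℝ) (v : Fin n → ℝ), h.totalDegree ≤ 2 ^ q ∧ L (h ^ 2) = 1 ∧
      v ⬝ᵥ v = 1 ∧ R < L (h ^ 2 * linForm v) := by
  have hq : 1 ≤ 2 ^ q := Nat.one_le_two_pow
  have hlin : ∀ v : Fin n → ℝ, 0 ≤ L (linForm v ^ 2) := fun v =>
    hL.sq_nonneg _ (by have := totalDegree_linForm_le v; omega)
  have hf0 : 0 ≤ L (linForm e ^ 2 + ∑ j, linForm (a j) ^ 2) := by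
    rw [map_add, map_sum]
    exact add_nonneg (hlin e) (Finset.sum_nonneg fun j _ => hlin (a j))
  have hlin2 : ∀ v : Fin n → ℝ, (linForm v ^ 2).totalDegree ≤ 2 := fun v =>
    (totalDegree_pow _ _).trans (by have := totalDegree_linForm_le v; omega)
  have hdeg : (linForm e ^ 2 + ∑ j, linForm (a j) ^ 2).totalDegree ≤ 2 :=
    (totalDegree_add _ _).trans (max_le (hlin2 e) (totalDegree_finsetSum_le fun j _ => hlin2 _))
  have hpow := hL.pow_two_pow_le hf0 q (by nlinarith)
  obtain ⟨w, hw⟩ : ∃ w : Fin n → ℝ,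
      (R ^ 2) ^ (2 ^ q) * (w ⬝ᵥ w) ^ (2 ^ q) < L (linForm w ^ (2 * 2 ^ q)) := by
    by_contra! H
    have := apply_quadratic_pow_le L (by positivity) H he hea haa h0 hc
    linarith
  have hw0 : 0 < w ⬝ᵥ w := by
    rcases (show 0 ≤ w ⬝ᵥ w from Finset.sum_nonneg fun i _ => mul_self_nonneg _).eq_or_lt
      with h | h
    · have : w = 0 := by simpa using dotProduct_self_eq_zero.1 h.symm
      subst this
      have : linForm (0 : Fin n → ℝ) = 0 := by simp [linForm]
      rw [this, zero_pow (by positivity), map_zero, zero_dotProduct,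
        zero_pow (by positivity), mul_zero] at hw
      exact absurd hw (lt_irrefl _)
    · exact h
  set s := (√(w ⬝ᵥ w))⁻¹ with hs
  have hs2 : s ^ 2 * (w ⬝ᵥ w) = 1 := by
    rw [hs, inv_pow, Real.sq_sqrt hw0.le, inv_mul_cancel₀ hw0.ne']
  have hs0 : 0 < s := by positivity
  have hunit : (s • w) ⬝ᵥ (s • w) = 1 := by
    rw [smul_dotProduct, dotProduct_smul, smul_eq_mul, smul_eq_mul, ← hs2]
    ring
  have hmom : R ^ (2 * 2 ^ q) < L (linForm (s • w) ^ (2 * 2 ^ q)) := by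
    rw [linForm_smul, smul_pow, map_smul, smul_eq_mul]
    calc R ^ (2 * 2 ^ q) = s ^ (2 * 2 ^ q) * ((R ^ 2) ^ (2 ^ q) * (w ⬝ᵥ w) ^ (2 ^ q)) := by
          rw [pow_mul s, mul_left_comm, ← mul_pow (s ^ 2), hs2, one_pow, mul_one, ← pow_mul]
      _ < _ := by gcongr
  obtain ⟨h, hh, h1, h2⟩ := hL.exists_sq_reweight_abs hR (totalDegree_linForm_le _) hd hmom
  rcases lt_abs.1 h2 with h2 | h2
  · exact ⟨h, s • w, hh, h1, hunit, h2⟩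
  · refine ⟨h, -(s • w), hh, h1, by simpa using hunit, ?_⟩
    rwa [linForm_neg, mul_neg, map_neg]

end IsPseudoExpectation

end PseudoExpectation

open Matrix

/-! ### Frobenius norms and the choice of short directions -/

section Frobenius

variable {n : ℕ}

lemma frobNorm_nonneg (A : Matrix (Fin n) (Fin n) ℝ) : 0 ≤ frobNorm A := Real.sqrt_nonneg _

lemma frobNorm_sq (A : Matrix (Fin n) (Fin n) ℝ) : frobNorm A ^ 2 = trace (Aᵀ * A) := by
  rw [frobNorm, Real.sq_sqrt (by positivity), Finset.sum_comm]
  simp [trace, mul_apply, sq]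

lemma frobNorm_add_le (A B : Matrix (Fin n) (Fin n) ℝ) :
    frobNorm (A + B) ≤ frobNorm A + frobNorm B := by
  let _ : NormedAddCommGroup (Matrix (Fin n) (Fin n) ℝ) := Matrix.frobeniusNormedAddCommGroup
  have h : ∀ M : Matrix (Fin n) (Fin n) ℝ, frobNorm M = ‖M‖ := by
    intro M
    rw [frobenius_norm_def, frobNorm, Real.sqrt_eq_rpow]
    simp
  rw [h, h, h]
  exact norm_add_le A B

lemma frobNorm_eq_of_sq_eq {A B : Matrix (Fin n) (Fin n) ℝ}
    (h : trace (Aᵀ * A) = trace (Bᵀ * B)) : frobNorm A = frobNorm B := by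
  rw [← sq_eq_sq₀ (frobNorm_nonneg _) (frobNorm_nonneg _), frobNorm_sq, frobNorm_sq, h]

lemma sum_eigenvalues_sq {A : Matrix (Fin n) (Fin n) ℝ} (hA : A.IsHermitian) :
    ∑ i, hA.eigenvalues i ^ 2 = frobNorm A ^ 2 := by
  have hT : Aᵀ = A := by simpa using hA.eq
  rw [frobNorm_sq, hT]
  have h : A * A = Unitary.conjStarAlgAut ℝ _ hA.eigenvectorUnitary
      (diagonal (RCLike.ofReal ∘ hA.eigenvalues) * diagonal (RCLike.ofReal ∘ hA.eigenvalues)) := by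
    rw [map_mul, ← hA.spectral_theorem]
  rw [h, Unitary.conjStarAlgAut_apply, trace_mul_comm, ← mul_assoc, Unitary.coe_star_mul_self,
    one_mul, diagonal_mul_diagonal, trace_diagonal]
  simp [sq]

lemma posSemidef_exists_eq_transpose_mul_self {S : Matrix (Fin n) (Fin n) ℝ}
    (hS : S.PosSemidef) : ∃ B : Matrix (Fin n) (Fin n) ℝ, S = Bᵀ * B := by
  open scoped MatrixOrder in
  obtain ⟨B, hB⟩ := CStarAlgebra.nonneg_iff_eq_star_mul_self.mp hS.nonneg
  exact ⟨B, by simpa [star_eq_conjTranspose] using hB⟩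

/-- The orthogonal projection to the complement of a unit vector. -/
def compl (e : Fin n → ℝ) : Matrix (Fin n) (Fin n) ℝ := 1 - vecMulVec e e

lemma compl_transpose (e : Fin n → ℝ) : (compl e)ᵀ = compl e := by
  simp [compl, transpose_vecMulVec]

lemma compl_mul_self {e : Fin n → ℝ} (he : e ⬝ᵥ e = 1) : compl e * compl e = compl e := by
  simp [compl, sub_mul, mul_sub, vecMulVec_mul_vecMulVec, he]

lemma compl_mulVec_self {e : Fin n → ℝ} (he : e ⬝ᵥ e = 1) : compl e *ᵥ e = 0 := by
  simp [compl, sub_mulVec, vecMulVec_mulVec, he]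

/-- The Frobenius norm of a positive semidefinite matrix is at most the sum of the Frobenius norms
of its two diagonal blocks. -/
lemma frobNorm_le_add_compl {S : Matrix (Fin n) (Fin n) ℝ} (hS : S.PosSemidef) {e : Fin n → ℝ}
    (he : e ⬝ᵥ e = 1) :
    frobNorm S ≤ e ⬝ᵥ S *ᵥ e + frobNorm (compl e * S * compl e) := by
  have hnn : 0 ≤ e ⬝ᵥ S *ᵥ e := by simpa using hS.dotProduct_mulVec_nonneg e
  -- Passing from `Bᵀ * B` to `B * Bᵀ` keeps the norm, and `B * Bᵀ` splits along `1 = Q + P` without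
  -- cross terms; each summand has the norm of a diagonal block of `S`.
  obtain ⟨B, rfl⟩ := posSemidef_exists_eq_transpose_mul_self hS
  have hP := compl_transpose e
  have hPP := compl_mul_self he
  set P := compl e with hPdef
  set Q := vecMulVec e e with hQdef
  have hQ : Qᵀ = Q := by simp [hQdef, transpose_vecMulVec]
  have h1 : frobNorm (Bᵀ * B) = frobNorm (B * Bᵀ) := by
    apply frobNorm_eq_of_sq_eq
    simp only [transpose_mul, transpose_transpose]
    rw [mul_assoc, trace_mul_comm]
    simp only [mul_assoc]
  have h2 : B * Bᵀ = B * Q * Bᵀ + B * P * Bᵀ := by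
    rw [← add_mul, ← mul_add, hPdef, compl, ← hQdef, add_sub_cancel, mul_one]
  have h3 : frobNorm (B * P * Bᵀ) = frobNorm (P * (Bᵀ * B) * P) := by
    apply frobNorm_eq_of_sq_eq
    simp only [transpose_mul, transpose_transpose, hP]
    calc trace (B * (P * Bᵀ) * (B * P * Bᵀ)) = trace (B * (P * Bᵀ * B * P * Bᵀ)) := by
          simp only [mul_assoc]
      _ = trace (P * Bᵀ * B * P * Bᵀ * B) := by rw [trace_mul_comm]
      _ = trace ((P * P) * (Bᵀ * B) * (P * P) * (Bᵀ * B)) := by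
          rw [hPP]; simp only [mul_assoc]
      _ = trace (P * (P * (Bᵀ * B) * (P * P) * (Bᵀ * B))) := by simp only [mul_assoc]
      _ = trace (P * (Bᵀ * B) * (P * P) * (Bᵀ * B) * P) := by rw [trace_mul_comm]
      _ = _ := by simp only [mul_assoc]
  have h4 : frobNorm (B * Q * Bᵀ) = e ⬝ᵥ (Bᵀ * B) *ᵥ e := by
    rw [← sq_eq_sq₀ (frobNorm_nonneg _) hnn, frobNorm_sq]
    have : B * Q * Bᵀ = vecMulVec (B *ᵥ e) (B *ᵥ e) := by
      rw [hQdef, mul_vecMulVec, vecMulVec_mul, vecMul_transpose]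
    rw [this, transpose_vecMulVec, vecMulVec_mul_vecMulVec, trace_vecMulVec,
      ← mulVec_mulVec, dotProduct_mulVec e, vecMul_transpose]
    simp [sq]
  rw [h1, h2]
  refine (frobNorm_add_le _ _).trans ?_
  rw [h3, h4]

/-- Short orthogonal vectors, orthogonal to the unit vector `e`, that capture the Frobenius norm of
a positive semidefinite matrix outside of the direction `e`. -/
lemma exists_orthogonal_family {S : Matrix (Fin n) (Fin n) ℝ} (hS : S.PosSemidef) {e : Fin n → ℝ}
    (he : e ⬝ᵥ e = 1) :
    ∃ (a : Fin n → Fin n → ℝ) (c : Fin n → ℝ), (∀ j, e ⬝ᵥ a j = 0) ∧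
      (∀ i j, a i ⬝ᵥ a j = if i = j then c i else 0) ∧ (∀ j, 0 ≤ c j) ∧ (∀ j, c j ≤ 3 / 8) ∧
      ∑ j, c j ≤ 3 / 8 * √n ∧
      3 / 8 * frobNorm S ≤ e ⬝ᵥ S *ᵥ e + ∑ j, a j ⬝ᵥ S *ᵥ a j := by
  have hT : (compl e * S * compl e).PosSemidef := by
    have := hS.conjTranspose_mul_mul_same (compl e)
    rwa [conjTranspose_eq_transpose_of_trivial, compl_transpose] at this
  set T := compl e * S * compl e with hTdef
  set F := frobNorm T with hF
  have hF0 : 0 ≤ F := frobNorm_nonneg _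
  set σ := hT.1.eigenvalues with hσ
  have hσ0 : ∀ j, 0 ≤ σ j := hT.eigenvalues_nonneg
  have hσF : ∑ j, σ j ^ 2 = F ^ 2 := sum_eigenvalues_sq hT.1
  have hσle : ∀ j, σ j ≤ F := by
    intro j
    rw [← sq_le_sq₀ (hσ0 j) hF0, ← hσF]
    exact Finset.single_le_sum (f := fun j => σ j ^ 2) (fun _ _ => sq_nonneg _)
      (Finset.mem_univ j)
  have hσsum : ∑ j, σ j ≤ √n * F := by
    rw [← sq_le_sq₀ (Finset.sum_nonneg fun j _ => hσ0 j) (by positivity), mul_pow,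
      Real.sq_sqrt (by positivity), ← hσF]
    simpa using sq_sum_le_card_mul_sum_sq (s := Finset.univ) (f := σ)
  set u : Fin n → Fin n → ℝ := fun j => (hT.1.eigenvectorBasis j).ofLp with hu
  have hTu : ∀ j, T *ᵥ u j = σ j • u j := fun j => hT.1.mulVec_eigenvectorBasis j
  have huu : ∀ i j, u i ⬝ᵥ u j = if i = j then 1 else 0 := by
    intro i j
    have := orthonormal_iff_ite.1 hT.1.eigenvectorBasis.orthonormal j i
    rw [EuclideanSpace.inner_eq_star_dotProduct] at this
    simp only [star_trivial] at this
    rw [hu]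
    simp only [this, eq_comm]
  have hPe := compl_mulVec_self he
  -- Since `T` annihilates `e`, only eigenvectors of eigenvalue zero can fail to be orthogonal to
  -- `e`, and these receive weight zero.
  have heu : ∀ j, σ j * (e ⬝ᵥ u j) = 0 := by
    intro j
    rw [← smul_eq_mul, ← dotProduct_smul, ← hTu, dotProduct_mulVec, hTdef, mul_assoc,
      ← vecMul_vecMul, ← mulVec_transpose (compl e), compl_transpose, hPe, zero_vecMul,
      zero_dotProduct]
  have hSu : ∀ j, σ j ≠ 0 → u j ⬝ᵥ S *ᵥ u j = σ j := by
    intro j hj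
    have h1 : e ⬝ᵥ u j = 0 := by simpa [hj] using heu j
    have h2 : compl e *ᵥ u j = u j := by
      simp [compl, sub_mulVec, vecMulVec_mulVec, h1]
    have h3 := congrArg (fun w => u j ⬝ᵥ w) (hTu j)
    simp only [dotProduct_smul, huu, if_true, smul_eq_mul, mul_one] at h3
    rw [hTdef, ← mulVec_mulVec, ← mulVec_mulVec, h2, dotProduct_mulVec, ← mulVec_transpose,
      compl_transpose, h2] at h3
    exact h3
  have hc0 : ∀ j, 0 ≤ 3 / 8 * (σ j / F) := fun j =>
    mul_nonneg (by norm_num) (div_nonneg (hσ0 j) hF0)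
  -- Squared lengths proportional to `σ j` capture `3/8 * ∑ σ j ^ 2 / F = 3/8 * F`, while `∑ σ j ≤
  -- √n * F` bounds their total. If `F = 0`, division by zero makes all of them vanish.
  refine ⟨fun j => √(3 / 8 * (σ j / F)) • u j, fun j => 3 / 8 * (σ j / F), ?_, ?_, hc0, ?_, ?_, ?_⟩
  · intro j
    rw [dotProduct_smul, smul_eq_mul]
    rcases mul_eq_zero.1 (heu j) with h | h <;> simp [h]
  · intro i j
    rw [smul_dotProduct, dotProduct_smul, huu]
    split_ifs with h
    · subst h
      simp only [smul_eq_mul, mul_one]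
      exact Real.mul_self_sqrt (hc0 i)
    · simp
  · intro j
    have := div_le_one_of_le₀ (hσle j) hF0
    linarith
  · rw [← Finset.mul_sum, ← Finset.sum_div]
    have := div_le_of_le_mul₀ hF0 (Real.sqrt_nonneg _) hσsum
    linarith
  · have hterm : ∀ j, (√(3 / 8 * (σ j / F)) • u j) ⬝ᵥ S *ᵥ (√(3 / 8 * (σ j / F)) • u j)
        = 3 / 8 * (σ j ^ 2 / F) := by
      intro j
      rw [mulVec_smul, smul_dotProduct, dotProduct_smul, smul_eq_mul, smul_eq_mul, ← mul_assoc,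
        Real.mul_self_sqrt (hc0 j)]
      by_cases h : σ j = 0
      · simp [h]
      · rw [hSu j h]; ring
    simp only [hterm]
    rw [← Finset.mul_sum, ← Finset.sum_div, hσF]
    have h1 := frobNorm_le_add_compl hS he
    have h2 : F ^ 2 / F = F := by
      rcases eq_or_ne F 0 with h | h
      · simp [h]
      · field_simp
    have hnn : 0 ≤ e ⬝ᵥ S *ᵥ e := by simpa using hS.dotProduct_mulVec_nonneg e
    rw [h2]
    rw [← hTdef, ← hF] at h1
    linarith

lemma trace_le_sqrt_mul_frobNorm (A : Matrix (Fin n) (Fin n) ℝ) :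
    trace A ≤ √n * frobNorm A := by
  apply le_of_sq_le_sq _ (mul_nonneg (Real.sqrt_nonneg _) (frobNorm_nonneg _))
  rw [mul_pow, Real.sq_sqrt (by positivity), frobNorm, Real.sq_sqrt (by positivity)]
  have h1 := sq_sum_le_card_mul_sum_sq (s := Finset.univ) (f := fun i => A i i)
  simp only [Finset.card_univ, Fintype.card_fin] at h1
  refine h1.trans (mul_le_mul_of_nonneg_left (Finset.sum_le_sum fun i _ => ?_) (by positivity))
  exact Finset.single_le_sum (f := fun j => A i j ^ 2) (fun _ _ => sq_nonneg _)
    (Finset.mem_univ i)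

end Frobenius

/-! ### Mean, covariance and the choice of parameters -/

section Covariance

variable {n d : ℕ} (L : MvPolynomial (Fin n) ℝ →ₗ[ℝ] ℝ)

/-- The mean of the coordinates under a linear functional. -/
noncomputable def meanVec : Fin n → ℝ := fun i => L (X i)

/-- The covariance matrix of the coordinates under a linear functional. -/
noncomputable def covMatrix : Matrix (Fin n) (Fin n) ℝ :=
  Matrix.of (fun i j => L (X i * X j)) - vecMulVec (meanVec L) (meanVec L)

lemma apply_mul_linForm (f : MvPolynomial (Fin n) ℝ) (v : Fin n → ℝ) :
    L (f * linForm v) = v ⬝ᵥ fun i => L (f * X i) := by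
  simp [linForm, Finset.mul_sum, dotProduct]

lemma apply_linForm (v : Fin n → ℝ) : L (linForm v) = v ⬝ᵥ meanVec L := by
  have := apply_mul_linForm L 1 v
  simp only [one_mul] at this
  exact this

lemma apply_linForm_sq (v : Fin n → ℝ) :
    L (linForm v ^ 2) = v ⬝ᵥ covMatrix L *ᵥ v + (v ⬝ᵥ meanVec L) ^ 2 := by
  have h1 : L (linForm v ^ 2) = v ⬝ᵥ Matrix.of (fun i j => L (X i * X j)) *ᵥ v := by
    rw [sq, apply_mul_linForm]
    congr 1
    ext i
    rw [mul_comm, apply_mul_linForm]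
    simp [mulVec, dotProduct, mul_comm]
  rw [h1, covMatrix, sub_mulVec, dotProduct_sub, vecMulVec_mulVec]
  simp [dotProduct_comm (meanVec L) v]
  ring

variable {L}

/-- Combined with `trace_le_sqrt_mul_frobNorm`, this gives `1 - M ≤ √n * F`, so mean and covariance
cannot both be small; the bound `1 / (4 * √n)` comes from here. -/
lemma trace_covMatrix (hone : L 1 = 1) (hsph : L (∑ i, X i ^ 2 - 1) = 0) :
    trace (covMatrix L) = 1 - meanVec L ⬝ᵥ meanVec L := by
  rw [map_sub, hone, map_sum, sub_eq_zero] at hsph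
  rw [covMatrix, trace_sub, trace_vecMulVec, ← hsph]
  simp [trace, sq]

lemma IsPseudoExpectation.posSemidef_covMatrix (hL : IsPseudoExpectation d L) (hd : 2 ≤ d) :
    (covMatrix L).PosSemidef := by
  refine PosSemidef.of_dotProduct_mulVec_nonneg ?_ fun v => ?_
  · ext i j
    simp [covMatrix, vecMulVec_apply, mul_comm]
  · have hdeg : (linForm v - C (v ⬝ᵥ meanVec L)).totalDegree ≤ 1 :=
      (totalDegree_sub _ _).trans (by simpa using totalDegree_linForm_le v)
    have h := hL.sq_nonneg _ (show 2 * (linForm v - C (v ⬝ᵥ meanVec L)).totalDegree ≤ d by omega)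
    have e : (linForm v - C (v ⬝ᵥ meanVec L)) ^ 2 = linForm v ^ 2 -
        C (2 * (v ⬝ᵥ meanVec L)) * linForm v + C ((v ⬝ᵥ meanVec L) ^ 2) * 1 := by
      simp only [map_mul, map_pow, map_ofNat]
      ring
    rw [e, map_add, map_sub, linearMap_C_mul, linearMap_C_mul, hL.map_one, apply_linForm_sq,
      apply_linForm] at h
    rw [star_trivial]
    linarith

lemma exists_unit_dotProduct_sq (hn : 0 < n) (v : Fin n → ℝ) :
    ∃ e : Fin n → ℝ, e ⬝ᵥ e = 1 ∧ (e ⬝ᵥ v) ^ 2 = v ⬝ᵥ v := by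
  rcases (show 0 ≤ v ⬝ᵥ v from Finset.sum_nonneg fun i _ => mul_self_nonneg _).eq_or_lt with h | h
  · have : v = 0 := dotProduct_self_eq_zero.1 h.symm
    exact ⟨Pi.single ⟨0, hn⟩ 1, by simp, by simp [this]⟩
  · have hs : (√(v ⬝ᵥ v))⁻¹ ^ 2 * (v ⬝ᵥ v) = 1 := by
      rw [inv_pow, Real.sq_sqrt h.le, inv_mul_cancel₀ h.ne']
    refine ⟨(√(v ⬝ᵥ v))⁻¹ • v, ?_, ?_⟩
    · rw [smul_dotProduct, dotProduct_smul, smul_eq_mul, smul_eq_mul, ← hs]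
      ring
    · rw [smul_dotProduct, smul_eq_mul, mul_pow]
      nlinarith

lemma exp_half_le_one_add {x : ℝ} (h0 : 0 ≤ x) (h1 : x ≤ 1) : Real.exp (x / 2) ≤ 1 + x := by
  have h := Real.add_one_le_exp (-(x / 2))
  have h2 : Real.exp (x / 2) * Real.exp (-(x / 2)) = 1 := by rw [← Real.exp_add]; simp
  nlinarith [Real.exp_pos (x / 2)]

/-- The reweighting lemma for abstract pseudo-expectations. -/
theorem IsPseudoExpectation.exists_sq_reweight_mean_gt (hL : IsPseudoExpectation d L) (hn : 0 < n)
    {ε : ℝ} (hε : 0 < ε) {k : ℕ} (hk : 120 * (√n * max 1 (1 / ε)) ≤ k) (hd : k + 2 ≤ d)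
    (hsph : L (∑ i, X i ^ 2 - 1) = 0)
    (hcov : ε * (meanVec L ⬝ᵥ meanVec L) < frobNorm (covMatrix L)) :
    ∃ h : MvPolynomial (Fin n) ℝ, 2 * h.totalDegree ≤ k ∧ L (h ^ 2) = 1 ∧
      max ((1 + ε / 4) * (meanVec L ⬝ᵥ meanVec L)) (1 / (4 * √n)) <
        ∑ i, L (h ^ 2 * X i) ^ 2 := by
  set M := meanVec L ⬝ᵥ meanVec L with hM
  have hM0 : 0 ≤ M := Finset.sum_nonneg fun i _ => mul_self_nonneg _
  have hn1 : 1 ≤ √(n : ℝ) := Real.one_le_sqrt.2 (by exact_mod_cast hn)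
  have hS := hL.posSemidef_covMatrix (by omega)
  set F := frobNorm (covMatrix L) with hF
  have htrace := trace_le_sqrt_mul_frobNorm (covMatrix L)
  rw [trace_covMatrix hL.map_one hsph, ← hM, ← hF] at htrace
  obtain ⟨e, he, hem⟩ := exists_unit_dotProduct_sq hn (meanVec L)
  obtain ⟨a, c, hea, haa, h0, hc, hcsum, hfrob⟩ := exists_orthogonal_family hS he
  have hLf : M + 3 / 8 * F ≤ L (linForm e ^ 2 + ∑ j, linForm (a j) ^ 2) := by
    rw [map_add, map_sum, apply_linForm_sq, hem]
    have : ∑ j, a j ⬝ᵥ covMatrix L *ᵥ a j ≤ ∑ j, L (linForm (a j) ^ 2) := by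
      refine Finset.sum_le_sum fun j _ => ?_
      rw [apply_linForm_sq]
      exact le_add_of_nonneg_right (_root_.sq_nonneg _)
    linarith
  set B := max ((1 + ε / 4) * M) (1 / (4 * √n)) with hB
  have hB0 : 0 < B := lt_max_of_lt_right (by positivity)
  set δ := min 1 ε with hδ
  have hδ0 : 0 < δ := lt_min one_pos hε
  have hδ1 : δ ≤ 1 := min_le_left _ _
  have hδε : δ ≤ ε := min_le_right _ _
  have hmax : max 1 (1 / ε) * δ = 1 := by
    rcases le_total ε 1 with h | h
    · rw [hδ, min_eq_right h, max_eq_right (by rw [le_div_iff₀ hε]; linarith)]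
      field_simp
    · rw [hδ, min_eq_left h, max_eq_left (by rw [div_le_iff₀ hε]; linarith)]
      norm_num
  have hgain : (1 + δ / 10) * B ≤ M + 3 / 8 * F := by
    rw [hB, mul_max_of_nonneg _ _ (by positivity)]
    refine max_le ?_ ?_
    · have h1 : δ * M ≤ ε * M := by gcongr
      have h2 : δ * (ε * M) ≤ 1 * (ε * M) := by gcongr
      -- Since `δ ≤ 1` and `δ ≤ ε`, the excess over `M` is at most `(1/10 + 1/4 + 1/40) * ε * M =
      -- 3/8 * ε * M`, which `hcov` bounds by `3/8 * F`.
      nlinarith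
    · have h1 : (1 + δ / 10) * (1 / (4 * √n)) ≤ 11 / 10 * (1 / (4 * √n)) := by
        gcongr
        linarith
      refine h1.trans ?_
      rw [← mul_div_assoc, mul_one, div_le_iff₀ (by positivity)]
      nlinarith
  -- The largest power of two for which `h ^ 2` still has degree at most `k`.
  obtain ⟨q, hq1, hq2⟩ : ∃ q : ℕ, 2 * 2 ^ q ≤ k ∧ k < 4 * 2 ^ q := by
    have hmax1 : (1 : ℝ) ≤ max 1 (1 / ε) := le_max_left _ _
    have hk2 : 2 ≤ k := by
      have : (2 : ℝ) ≤ k := by nlinarith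
      exact_mod_cast this
    have hlog : 1 ≤ Nat.log 2 k := Nat.log_pos (by norm_num) hk2
    refine ⟨Nat.log 2 k - 1, ?_, ?_⟩
    · rw [← pow_succ', Nat.sub_add_cancel hlog]
      exact Nat.pow_log_le_self 2 (by omega)
    · have := Nat.lt_pow_succ_log_self (b := 2) (by norm_num) k
      obtain ⟨r, hr⟩ : ∃ r, Nat.log 2 k = r + 1 := ⟨Nat.log 2 k - 1, by omega⟩
      rw [hr] at this ⊢
      rw [Nat.add_sub_cancel]
      calc k < _ := this
        _ = 4 * 2 ^ r := by rw [Nat.succ_eq_add_one]; ring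
  have hq2' : (k : ℝ) < 4 * 2 ^ q := by exact_mod_cast hq2
  -- The exponent on the left is at most `3/2 * √n`. As `4 * 2 ^ q > k ≥ 120 * √n / δ`, one has `2 ^
  -- q * δ / 20 > 3/2 * √n`, which fixes the constant `120`.
  have hexp : Real.exp (4 * ∑ j, c j) < (1 + δ / 10) ^ (2 ^ q) := by
    have h1 : Real.exp (4 * ∑ j, c j) ≤ Real.exp (3 / 2 * √n) := by
      apply Real.exp_le_exp.2
      linarith
    have h2 : Real.exp (3 / 2 * √n) < Real.exp ((2 ^ q : ℕ) * (δ / 10 / 2)) := by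
      apply Real.exp_lt_exp.2
      push_cast
      have h3 : 120 * (√n * max 1 (1 / ε)) * δ < 4 * 2 ^ q * δ :=
        mul_lt_mul_of_pos_right (hk.trans_lt hq2') hδ0
      have h4 : 120 * (√n * max 1 (1 / ε)) * δ = 120 * √n * (max 1 (1 / ε) * δ) := by ring
      rw [h4, hmax] at h3
      linarith
    calc _ ≤ _ := h1
      _ < _ := h2
      _ = Real.exp (δ / 10 / 2) ^ (2 ^ q) := by rw [Real.exp_nat_mul]
      _ ≤ _ := by
        gcongr
        exact exp_half_le_one_add (by positivity) (by linarith)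
  have hR2 : √B ^ 2 = B := Real.sq_sqrt hB0.le
  obtain ⟨h, v, hh, hh1, hv, hlarge⟩ := hL.exists_sq_reweight (Real.sqrt_pos.2 hB0)
    (show 2 * 2 ^ q + 2 ≤ d by omega) he hea haa h0 hc (by
      rw [hR2]
      calc B ^ 2 ^ q * Real.exp (4 * ∑ j, c j) < B ^ 2 ^ q * (1 + δ / 10) ^ (2 ^ q) := by gcongr
        _ = ((1 + δ / 10) * B) ^ 2 ^ q := by rw [mul_pow, mul_comm]
        _ ≤ _ := by
          gcongr
          exact hgain.trans hLf)
  refine ⟨h, by omega, hh1, ?_⟩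
  rw [apply_mul_linForm] at hlarge
  have hcs := Finset.sum_mul_sq_le_sq_mul_sq Finset.univ v (fun i => L (h ^ 2 * X i))
  have hv' : ∑ i, v i ^ 2 = 1 := by rw [← hv]; simp [dotProduct, sq]
  rw [hv', one_mul] at hcs
  calc B = √B ^ 2 := hR2.symm
    _ < (v ⬝ᵥ fun i => L (h ^ 2 * X i)) ^ 2 := by gcongr
    _ ≤ _ := hcs

end Covariance

/-! ### Distributions and pseudo-distributions as pseudo-expectations -/

variable {n : ℕ}

lemma polyEval_add (f g : MvPolynomial (Fin n) ℝ) (x : EuclideanSpace ℝ (Fin n)) :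
    polyEval (f + g) x = polyEval f x + polyEval g x := by simp [polyEval]

lemma polyEval_mul (f g : MvPolynomial (Fin n) ℝ) (x : EuclideanSpace ℝ (Fin n)) :
    polyEval (f * g) x = polyEval f x * polyEval g x := by simp [polyEval]

lemma polyEval_smul (r : ℝ) (f : MvPolynomial (Fin n) ℝ) (x : EuclideanSpace ℝ (Fin n)) :
    polyEval (r • f) x = r * polyEval f x := by simp [polyEval, smul_eval]

lemma polyEval_pow (f : MvPolynomial (Fin n) ℝ) (j : ℕ) (x : EuclideanSpace ℝ (Fin n)) :
    polyEval (f ^ j) x = polyEval f x ^ j := by simp [polyEval]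

lemma polyEval_X (i : Fin n) (x : EuclideanSpace ℝ (Fin n)) : polyEval (X i) x = x i := by
  simp [polyEval]

lemma polyEval_one (x : EuclideanSpace ℝ (Fin n)) : polyEval 1 x = 1 := by
  simp [polyEval]

lemma polyEval_sphere {x : EuclideanSpace ℝ (Fin n)} (hx : x ∈ Metric.sphere 0 1) :
    polyEval (∑ i, X i ^ 2 - 1) x = 0 := by
  have h : ‖x‖ ^ 2 = 1 := by rw [mem_sphere_zero_iff_norm.1 hx, one_pow]
  rw [EuclideanSpace.real_norm_sq_eq] at h
  simp [polyEval, h]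

lemma continuous_polyEval (f : MvPolynomial (Fin n) ℝ) : Continuous (polyEval f) := by
  unfold polyEval
  exact (MvPolynomial.continuous_eval f).comp (by fun_prop)

section Distributions

variable {μ : Measure (EuclideanSpace ℝ (Fin n))} (hμ : IsDistOnSphere μ)

lemma IsDistOnSphere.integrable_of_continuous {E : Type*} [NormedAddCommGroup E]
    [SecondCountableTopology E] (hμ : IsDistOnSphere μ) {g : EuclideanSpace ℝ (Fin n) → E}
    (hg : Continuous g) : Integrable g μ := by
  have := hμ.1
  obtain ⟨c, hc⟩ := (isCompact_sphere (0 : EuclideanSpace ℝ (Fin n)) 1).exists_bound_of_continuousOn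
    hg.continuousOn
  exact Integrable.of_bound hg.aestronglyMeasurable c (hμ.2.mono hc)

/-- The expectation of polynomials under a distribution on the sphere. -/
noncomputable def expectation (hμ : IsDistOnSphere μ) : MvPolynomial (Fin n) ℝ →ₗ[ℝ] ℝ where
  toFun f := ∫ x, polyEval f x ∂μ
  map_add' f g := by
    simp only [polyEval_add]
    exact integral_add (hμ.integrable_of_continuous (continuous_polyEval f))
      (hμ.integrable_of_continuous (continuous_polyEval g))
  map_smul' r f := by
    simp only [polyEval_smul]
    exact integral_const_mul _ _

lemma expectation_apply (f : MvPolynomial (Fin n) ℝ) :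
    expectation hμ f = ∫ x, polyEval f x ∂μ := rfl

lemma isPseudoExpectation_expectation (d : ℕ) : IsPseudoExpectation d (expectation hμ) where
  map_one := by
    have := hμ.1
    simp [expectation_apply, polyEval_one]
  sq_nonneg f _ := by
    rw [expectation_apply]
    exact integral_nonneg fun x => by simp only [polyEval_pow]; exact sq_nonneg _

lemma expectation_sphere : expectation hμ (∑ i, X i ^ 2 - 1) = 0 := by
  rw [expectation_apply]
  exact integral_eq_zero_of_ae (hμ.2.mono fun x hx => polyEval_sphere hx)

lemma mean_apply (hμ : IsDistOnSphere μ) (i : Fin n) : mean μ i = ∫ x, x i ∂μ := by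
  have h := (EuclideanSpace.proj i : EuclideanSpace ℝ (Fin n) →L[ℝ] ℝ).integral_comp_comm
    (hμ.integrable_of_continuous continuous_id)
  simpa [mean] using h.symm

lemma meanVec_expectation : meanVec (expectation hμ) = (mean μ).ofLp := by
  ext i
  rw [mean_apply hμ, meanVec, expectation_apply]
  simp only [polyEval_X]

lemma covMatrix_expectation : covMatrix (expectation hμ) =
    secondMoment μ - vecMulVec (mean μ).ofLp (mean μ).ofLp := by
  rw [covMatrix, meanVec_expectation]
  congr 1
  ext i j
  simp only [secondMoment, Matrix.of_apply, expectation_apply, polyEval_mul, polyEval_X]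

lemma norm_sq_eq_dotProduct (x : EuclideanSpace ℝ (Fin n)) : ‖x‖ ^ 2 = x.ofLp ⬝ᵥ x.ofLp := by
  rw [EuclideanSpace.real_norm_sq_eq]
  simp [dotProduct, sq]

lemma isDistOnSphere_reweight {p : MvPolynomial (Fin n) ℝ} (hp : ∀ x, 0 ≤ polyEval p x)
    (h1 : expectation hμ p = 1) : IsDistOnSphere (reweight μ p) := by
  refine ⟨⟨?_⟩, (withDensity_absolutelyContinuous μ _).ae_le hμ.2⟩
  rw [reweight, withDensity_apply _ MeasurableSet.univ, Measure.restrict_univ,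
    ← ofReal_integral_eq_lintegral_ofReal (hμ.integrable_of_continuous (continuous_polyEval p))
      (ae_of_all _ hp), ← expectation_apply hμ, h1, ENNReal.ofReal_one]

lemma norm_sq_mean_reweight {p : MvPolynomial (Fin n) ℝ} (hp : ∀ x, 0 ≤ polyEval p x)
    (h1 : expectation hμ p = 1) :
    ‖mean (reweight μ p)‖ ^ 2 = ∑ i, expectation hμ (p * X i) ^ 2 := by
  rw [EuclideanSpace.real_norm_sq_eq]
  refine Finset.sum_congr rfl fun i _ => ?_
  rw [mean_apply (isDistOnSphere_reweight hμ hp h1), reweight,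
    integral_withDensity_eq_integral_toReal_smul
      (continuous_polyEval p).measurable.ennreal_ofReal (ae_of_all _ fun _ => ENNReal.ofReal_lt_top),
    expectation_apply]
  congr 2
  ext x
  rw [ENNReal.toReal_ofReal (hp x), polyEval_mul, polyEval_X, smul_eq_mul]

end Distributions

section PseudoDistributions

variable {d : ℕ} (μ : EuclideanSpace ℝ (Fin n) →₀ ℝ)

/-- The pseudo-expectation of a finitely supported function as a linear functional. -/
noncomputable def pseudoExpectation : MvPolynomial (Fin n) ℝ →ₗ[ℝ] ℝ where
  toFun f := pseudoExp μ f
  map_add' f g := by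
    simp only [pseudoExp, polyEval_add, mul_add, Finset.sum_add_distrib]
  map_smul' r f := by
    simp only [pseudoExp, polyEval_smul, Finset.mul_sum, RingHom.id_apply, smul_eq_mul]
    exact Finset.sum_congr rfl fun x _ => by ring

lemma covMatrix_pseudoExpectation : covMatrix (pseudoExpectation μ) =
    pseudoSecondMoment μ - vecMulVec (pseudoMean μ).ofLp (pseudoMean μ).ofLp := rfl

lemma pseudoExp_pseudoReweight (p f : MvPolynomial (Fin n) ℝ) :
    pseudoExp (pseudoReweight μ p) f = pseudoExp μ (p * f) := by
  rw [pseudoExp, pseudoExp]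
  have hsub : (pseudoReweight μ p).support ⊆ μ.support := Finsupp.support_onFinset_subset
  rw [Finset.sum_subset hsub fun x _ hx => by rw [Finsupp.notMem_support_iff.1 hx, zero_mul]]
  refine Finset.sum_congr rfl fun x _ => ?_
  rw [polyEval_mul, pseudoReweight, Finsupp.onFinset_apply]
  ring

variable {μ}

lemma isPseudoDistOnSphere_pseudoReweight (hμ : IsPseudoDistOnSphere d μ) {k : ℕ}
    {h : MvPolynomial (Fin n) ℝ} (hk : 2 * h.totalDegree ≤ k) (hkd : k ≤ d)
    (h1 : pseudoExp μ (h ^ 2) = 1) :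
    IsPseudoDistOnSphere (d - k) (pseudoReweight μ (h ^ 2)) := by
  refine ⟨⟨?_, fun f hf => ?_⟩, fun f hf => ?_⟩
  · rw [pseudoExp_pseudoReweight, mul_one, h1]
  · rw [pseudoExp_pseudoReweight, ← mul_pow]
    have := totalDegree_mul h f
    exact hμ.1.2 _ (by omega)
  · rw [pseudoExp_pseudoReweight, mul_left_comm]
    have h2 := totalDegree_mul (h ^ 2) f
    have h3 := totalDegree_pow h 2
    exact hμ.2 _ (by omega)

end PseudoDistributions

/-- The logarithmic factor serves only to absorb constants: `log 3 > 1.09` and `1.09 ^ 60 ≥ 121`,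
where the spare `1` pays for the floor because `A ≥ 1`. -/
lemma mul_le_floor_mul_log_pow {n : ℕ} (hn : 3 ≤ n) {A : ℝ} (hA : 1 ≤ A) :
    120 * A ≤ ⌊A * Real.log n ^ 60⌋₊ := by
  have h1 : (109 / 100 : ℝ) ≤ Real.log n := by
    have h2 := Real.log_three_gt_d9
    have h3 : Real.log 3 ≤ Real.log n := Real.log_le_log (by norm_num) (by exact_mod_cast hn)
    linarith
  have h4 : (121 : ℝ) ≤ Real.log n ^ 60 :=
    le_trans (by norm_num) (pow_le_pow_left₀ (by norm_num) h1 60)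
  have h5 := Nat.lt_floor_add_one (A * Real.log n ^ 60)
  nlinarith

end SOSReweighting

theorem corollary5p5 :
    ∃ C : ℕ, ∀ (n : ℕ), 3 ≤ n → ∀ (ε : ℝ), 0 < ε →
      ∀ k : ℕ, k = ⌊Real.sqrt n * max 1 (1 / ε) * Real.log n ^ C⌋₊ →
        -- distributions
        (∀ μ : MeasureTheory.Measure (EuclideanSpace ℝ (Fin n)),
          SOSReweighting.IsDistOnSphere μ →
          ε * ‖SOSReweighting.mean μ‖ ^ 2 <
            SOSReweighting.frobNorm (SOSReweighting.secondMoment μ -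
              Matrix.vecMulVec (SOSReweighting.mean μ).ofLp (SOSReweighting.mean μ).ofLp) →
          ∃ p : MvPolynomial (Fin n) ℝ,
            IsSumSq p ∧ p.totalDegree ≤ k ∧
            ∫ x, SOSReweighting.polyEval p x ∂μ = 1 ∧
            SOSReweighting.IsDistOnSphere (SOSReweighting.reweight μ p) ∧
            max ((1 + ε / 4) * ‖SOSReweighting.mean μ‖ ^ 2) (1 / (4 * Real.sqrt n)) <
              ‖SOSReweighting.mean (SOSReweighting.reweight μ p)‖ ^ 2) ∧
        -- pseudo-distributions
        (∀ (d : ℕ), k + 2 ≤ d → ∀ μ : EuclideanSpace ℝ (Fin n) →₀ ℝ,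
          SOSReweighting.IsPseudoDistOnSphere d μ →
          ε * ‖SOSReweighting.pseudoMean μ‖ ^ 2 <
            SOSReweighting.frobNorm (SOSReweighting.pseudoSecondMoment μ -
              Matrix.vecMulVec (SOSReweighting.pseudoMean μ).ofLp
                (SOSReweighting.pseudoMean μ).ofLp) →
          ∃ p : MvPolynomial (Fin n) ℝ,
            IsSumSq p ∧ p.totalDegree ≤ k ∧
            SOSReweighting.pseudoExp μ p = 1 ∧
            SOSReweighting.IsPseudoDistOnSphere (d - k) (SOSReweighting.pseudoReweight μ p) ∧
            max ((1 + ε / 4) * ‖SOSReweighting.pseudoMean μ‖ ^ 2) (1 / (4 * Real.sqrt n)) <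
              ‖SOSReweighting.pseudoMean (SOSReweighting.pseudoReweight μ p)‖ ^ 2) := by
  open SOSReweighting in
  refine ⟨60, fun n hn ε hε k hk => ?_⟩
  have hn0 : 0 < n := by omega
  have hkA : 120 * (√n * max 1 (1 / ε)) ≤ (k : ℝ) := by
    rw [hk]
    refine mul_le_floor_mul_log_pow hn (one_le_mul_of_one_le_of_one_le ?_ (le_max_left _ _))
    exact Real.one_le_sqrt.2 (by exact_mod_cast hn0)
  have hsq : ∀ h : MvPolynomial (Fin n) ℝ, IsSumSq (h ^ 2) := fun h => by
    rw [sq]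
    exact IsSumSq.mul_self h
  have hdeg : ∀ h : MvPolynomial (Fin n) ℝ, 2 * h.totalDegree ≤ k → (h ^ 2).totalDegree ≤ k :=
    fun h hh => (MvPolynomial.totalDegree_pow h 2).trans hh
  constructor
  · intro μ hμ hcov
    rw [norm_sq_eq_dotProduct, ← covMatrix_expectation hμ, ← meanVec_expectation hμ] at hcov
    obtain ⟨h, hh, h1, h2⟩ := (isPseudoExpectation_expectation hμ (k + 2)).exists_sq_reweight_mean_gt
      hn0 hε hkA le_rfl (expectation_sphere hμ) hcov
    have hp : ∀ x, 0 ≤ polyEval (h ^ 2) x := fun x => by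
      rw [polyEval_pow]
      exact sq_nonneg _
    refine ⟨h ^ 2, hsq h, hdeg h hh, h1, isDistOnSphere_reweight hμ hp h1, ?_⟩
    rw [norm_sq_mean_reweight hμ hp h1, norm_sq_eq_dotProduct, ← meanVec_expectation hμ]
    exact h2
  · intro d hd μ hμ hcov
    rw [norm_sq_eq_dotProduct, ← covMatrix_pseudoExpectation] at hcov
    -- The existence of `h` uses the sphere constraint only with multiplier `1`; the other
    -- multipliers serve to keep the reweighted function on the sphere.
    have hsph : pseudoExpectation μ (∑ i, MvPolynomial.X i ^ 2 - 1) = 0 := by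
      have := hμ.2 1 (by simp; omega)
      rwa [mul_one] at this
    have hL : IsPseudoExpectation d (pseudoExpectation μ) := ⟨hμ.1.1, hμ.1.2⟩
    obtain ⟨h, hh, h1, h2⟩ := hL.exists_sq_reweight_mean_gt hn0 hε hkA hd hsph hcov
    refine ⟨h ^ 2, hsq h, hdeg h hh, h1,
      isPseudoDistOnSphere_pseudoReweight hμ hh (by omega) h1, ?_⟩
    rw [norm_sq_eq_dotProduct, EuclideanSpace.real_norm_sq_eq]
    simp only [pseudoMean, pseudoExp_pseudoReweight]
    exact h2
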